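/- All graphs are finite and simple. Let $G$ be a connected graph with $n \ge 1$ nodes and node set $V$, together with a full color palette, that is, a set of $n-1$ distinct colors. If the colorful graph associahedron of $G$ (a collection of abstract polytopes, defined below) is regular, then $G$ is isomorphic to $K_1$, $K_2$, $K_3$ or the path $P_3$ on three nodes. Indeed it suffices that one polytope of the collection is regular. **Tubings.** A *tube* is a nonempty proper subset of $V$ inducing a connected subgraph. Two tubes are *compatible* if one properly contains the other, or if they are disjoint and no edge of $G$ joins them. A *tubing* $T$ is a set of pairwise compatible tubes. The *universal tube* is $V$ itself; it is not an element of $T$. **Cores.** For $t\in T\cup\{V\}$, the *core* of $t$ in $T$ is the graph whose nodes are the nodes of $t$ contained in no $s\in T$ with $s\subsetneq t$; two distinct such nodes are joined if they are adjacent in $G$, or if they both have a neighbor in some $s\in T$ with $s\subsetneq t$. Write $c_T(t)$ for its number of nodes and $k_T(t)$ for its connectivity, the least number of nodes whose removal disconnects it; here $K_m$ has connectivity $m-1$ for $m\ge2$, and $K_1$ has connectivity $1$. **Color templates.** A *color template* $(T,\mathcal O)$ is a tubing $T$ with a partition $\mathcal O$ of the palette into blocks attached to the tubes $t\in T\cup\{V\}$: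 each $t\in T$ carries a color of its own (first block), followed by an ordered list of $k_T(t)-1$ further colors (outer blocks), followed by an unordered set of $c_T(t)-k_T(t)$ colors (inner block); $V$ carries the same data except that it has no color of its own. **Order.** Let $(T',\mathcal O')$ and $(T,\mathcal O)$ be color templates with $T=T'\cup\{t\}$, $t\notin T'$, and let $t_*$ be the smallest element of $T\cup\{V\}$ properly containing $t$. The template $(T,\mathcal O)$ is *obtained from $(T',\mathcal O')$ by adding $t$* if all $s\in (T\cup\{V\})\setminus\{t,t_*\}$ have the same blocks in $\mathcal O$ as in $\mathcal O'$, and the colors of $t_*$ in $\mathcal O'$ can be listed, in the order of the blocks and with the inner block in some order, so that an initial segment of this list is a listing of the colors of $t_*$ in $\mathcal O$, in the order of its blocks there, and the rest is such a listing of the colors of $t$ in $\mathcal O$. Put $(T,\mathcal O)\preceq(T'',\mathcal O'')$ if $(T,\mathcal O)$ is obtained from $(T'',\mathcal O'')$ by successively adding finitely many (possibly zero) tubes. **Associahedron and regularity.** The *colorful graph associahedron* of $G$ is the collection of posets, one for each color template with empty tubing, consisting of all color templates $\preceq$ the given one together with an added least element. Such a poset is *regular* if its group of order automorphisms acts transitively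 on its flags (maximal chains). -/

import Mathlib

namespace ColorfulGA

section Graphs

variable {V : Type*} [Fintype V] [DecidableEq V]

/-- A tube of `G`: a (nonempty) proper set of nodes whose induced subgraph is connected. -/
def IsTube (G : SimpleGraph V) (t : Finset V) : Prop :=
  t ≠ Finset.univ ∧ (G.induce (t : Set V)).Connected

/-- Two tubes are compatible if one properly contains the other, or if they are disjoint and
cannot be connected by an edge of `G`. -/
def Compatible (G : SimpleGraph V) (s t : Finset V) : Prop :=
  s ⊂ t ∨ t ⊂ s ∨ (Disjoint s t ∧ ∀ u ∈ s, ∀ v ∈ t, ¬ G.Adj u v)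

/-- A tubing of `G`: a set of pairwise compatible tubes. -/
def IsTubing (G : SimpleGraph V) (T : Finset (Finset V)) : Prop :=
  (∀ t ∈ T, IsTube G t) ∧ ∀ s ∈ T, ∀ t ∈ T, s ≠ t → Compatible G s t

/-- The connectivity of a graph: the least number of nodes whose removal disconnects it, where a
complete graph on `n` nodes (which no removal disconnects) has connectivity `n - 1`.  For a
non-complete graph the second set does not matter, since the minimum is then at most `n - 2`. -/
noncomputable def connectivity {W : Type*} [Fintype W] (H : SimpleGraph W) : ℕ :=
  sInf ({k | ∃ S : Finset W, S.card = k ∧ ¬ (H.induce {w | w ∉ S}).Preconnected} ∪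
    {Fintype.card W - 1})

/-- The nodes of the core of `t` in `T`: those nodes of `t` contained in no tube of `T` that is
properly contained in `t`.  The universal tube is `t = Finset.univ`. -/
def coreNodes (T : Finset (Finset V)) (t : Finset V) : Finset V :=
  t.filter fun v => ∀ s ∈ T, s ⊂ t → v ∉ s

/-- The core graph of `t` in `T`.  Two nodes are joined if they are adjacent in `G` or connected by
a path through some tube `s` of `T` properly contained in `t`; as `s` is connected, such a path
exists exactly if both nodes have a neighbour in `s`. -/
def core (G : SimpleGraph V) (T : Finset (Finset V)) (t : Finset V) :
    SimpleGraph (coreNodes T t) where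
  Adj u v := u ≠ v ∧ (G.Adj u v ∨
    ∃ s ∈ T, s ⊂ t ∧ (∃ a ∈ s, G.Adj u a) ∧ (∃ b ∈ s, G.Adj v b))
  symm := ⟨by
    rintro u v ⟨hne, h⟩
    refine ⟨hne.symm, ?_⟩
    rcases h with h | ⟨s, hs, hst, ha, hb⟩
    · exact Or.inl h.symm
    · exact Or.inr ⟨s, hs, hst, hb, ha⟩⟩
  loopless := ⟨fun _ h => h.1 rfl⟩

/-- The number of outer blocks of the tube `t` (connectivity of the core, minus one).  For a core
with a single node this is `0`. -/
noncomputable def outerCount (G : SimpleGraph V) (T : Finset (Finset V)) (t : Finset V) : ℕ :=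
  connectivity (core G T t) - 1

end Graphs

section Templates

variable {V : Type*} [Fintype V] [DecidableEq V] {C : Type*}

/-- A full color palette for a graph with node set `V`: `n - 1` pairwise distinct colors, where `n`
is the number of nodes. -/
def IsFullPalette (V : Type*) [Fintype V] (palette : Multiset C) : Prop :=
  palette.card + 1 = Fintype.card V ∧ palette.Nodup

/-- A color template of a connected graph `G` with a color palette: a tubing together with a
partition of the palette into blocks attached to its tubes and to the universal tube
`Finset.univ`.

For a tube `t`, the list `ordered t` consists of the color of `t` followed by the colors of its
outer blocks, in order, and the (unordered) `inner t` is its inner block.  The universal tube is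
uncolored, so `ordered Finset.univ` consists of its outer blocks only.  The two `off` fields say
that no other set of nodes carries colors, so that two templates are equal exactly if they have the
same tubing and the same blocks. -/
@[ext]
structure ColorTemplate (G : SimpleGraph V) (palette : Multiset C) where
  tubing : Finset (Finset V)
  isTubing : IsTubing G tubing
  ordered : Finset V → List C
  inner : Finset V → Multiset C
  ordered_off : ∀ t ∉ insert Finset.univ tubing, ordered t = []
  inner_off : ∀ t ∉ insert Finset.univ tubing, inner t = 0
  length_ordered : ∀ t ∈ tubing, (ordered t).length = 1 + outerCount G tubing t
  card_inner : ∀ t ∈ tubing, (ordered t).length + (inner t).card = (coreNodes tubing t).card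
  length_ordered_univ : (ordered Finset.univ).length = outerCount G tubing Finset.univ
  card_inner_univ : (ordered Finset.univ).length + (inner Finset.univ).card + 1 =
    (coreNodes tubing Finset.univ).card
  partition : ∑ t ∈ insert Finset.univ tubing, ((ordered t : Multiset C) + inner t) = palette

namespace ColorTemplate

variable {G : SimpleGraph V} {palette : Multiset C}

/-- `Step P Q` says that `P` is compatible with `Q` and that the tubing of `P` arises from that of
`Q` by adding one tube `t`.  Here `u` is the smallest tube of `P`, possibly universal, that
properly contains `t`.  The blocks of all other tubes are unchanged.  The colors of `u` in `Q` are
put into a linear order that extends their partial order (`Q.ordered u`, then the inner block in any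
order `l`); the first of them, as many as the core of `u` in `P` requires, are the colors of `u` in
`P`, and the others are the colors of `t` in `P`; within `u` and within `t` the order is kept, up
to forgetting it on the inner blocks. -/
def Step (P Q : ColorTemplate G palette) : Prop :=
  ∃ t u : Finset V, t ∉ Q.tubing ∧ P.tubing = insert t Q.tubing ∧
    u ∈ insert Finset.univ P.tubing ∧ t ⊂ u ∧
    (∀ s ∈ insert Finset.univ P.tubing, t ⊂ s → u ⊆ s) ∧
    (∀ s, s ≠ t → s ≠ u → P.ordered s = Q.ordered s ∧ P.inner s = Q.inner s) ∧
    ∃ l l₁ l₂ : List C, (l : Multiset C) = Q.inner u ∧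
      (l₁ : Multiset C) = P.inner u ∧ (l₂ : Multiset C) = P.inner t ∧
      Q.ordered u ++ l = (P.ordered u ++ l₁) ++ (P.ordered t ++ l₂)

theorem Step.ssubset {P Q : ColorTemplate G palette} (h : Step P Q) : Q.tubing ⊂ P.tubing := by
  obtain ⟨t, u, ht, hP, -⟩ := h
  rw [hP]
  exact Finset.ssubset_insert ht

theorem subset_of_reflTransGen {P Q : ColorTemplate G palette}
    (h : Relation.ReflTransGen Step P Q) : Q.tubing ⊆ P.tubing := by
  induction h with
  | refl => exact Finset.Subset.refl _
  | tail _ hs ih => exact hs.ssubset.1.trans ih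

/-- Color templates are ordered by iterated addition of tubes: `P ≤ Q` if `P` arises from `Q` by
successively adding compatible tubes. -/
instance : PartialOrder (ColorTemplate G palette) where
  le := Relation.ReflTransGen Step
  le_refl _ := Relation.ReflTransGen.refl
  le_trans _ _ _ := Relation.ReflTransGen.trans
  le_antisymm P Q h₁ h₂ := by
    rcases Relation.ReflTransGen.cases_head h₁ with h | ⟨R, hR, hRQ⟩
    · exact h
    · exact absurd ((subset_of_reflTransGen h₂).trans (subset_of_reflTransGen hRQ))
        hR.ssubset.2

end ColorTemplate

/-- The color templates with empty tubing, that is, the distributions of the palette over the outer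
blocks and the inner block of the universal tube. They index the collection of posets
`Associahedron`. -/
def TopTemplate (G : SimpleGraph V) (palette : Multiset C) : Type _ :=
  {P : ColorTemplate G palette // P.tubing = ∅}

/-- The colorful graph associahedron of a connected graph `G` with a color palette, as a collection
of posets: for each color template `P` with empty tubing, the poset of all color templates below
`P`, together with a least face `⊥`. -/
abbrev Associahedron (G : SimpleGraph V) (palette : Multiset C) (P : TopTemplate G palette) :
    Type _ :=
  WithBot (Set.Iic P.1)

end Templates

/-- Combinatorial regularity: the automorphism group acts transitively on the flags. -/
def IsRegular (P : Type*) [PartialOrder P] : Prop :=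
  ∀ Φ Ψ : Flag P, ∃ σ : P ≃o P, Flag.map σ Φ = Ψ

end ColorfulGA

/-! In a regular poset all faces of the same height cover equally many faces
(`IsRegular.encard_covBy_eq`). For n ≥ 4 nodes this fails: every polytope of the collection has a
two-dimensional face with at most four edges and another with at least five.

Both faces come from a chain `t 0 ⊂ t 1 ⊂ ⋯` of connected sets that grows by one node at a time. One
face has the tubes `t 1, t 3, t 4, …`, the other has `t 2, t 3, t 4, …`; each tubing has n - 3
tubes. In the first, every core has at most two nodes, so a covered template is determined by the
added tube (`Step.eq_of_tubing_eq`), and only four tubes can be added (`exists_candidates`). In the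
second, any connected set strictly inside `t 2` can be added, and there are at least five of them
(`exists_five_tubes`). Colors never obstruct adding a tube (`exists_step`), so such faces exist
below any given top template and the tubes give a lower bound for the covered faces.

Hence n ≤ 3, and the connected graphs of that size are listed by hand. -/

namespace ColorfulGA

/-! ### Connected vertex sets and graph connectivity. -/

section Connectivity

variable {V : Type*} {G : SimpleGraph V}

theorem exists_adj_of_induce_connected {s m : Finset V} (hs : (G.induce (s : Set V)).Connected)
    (hm : m.Nonempty) (hms : m ⊂ s) : ∃ a ∈ m, ∃ b ∈ s, b ∉ m ∧ G.Adj a b := by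
  obtain ⟨x, hx⟩ := hm
  obtain ⟨y, hy, hym⟩ := Finset.exists_of_ssubset hms
  obtain ⟨p⟩ := hs.preconnected ⟨x, hms.1 hx⟩ ⟨y, hy⟩
  obtain ⟨d, -, h₁, h₂⟩ := p.exists_boundary_dart {z | z.1 ∈ m} hx hym
  exact ⟨d.fst, h₁, d.snd, d.snd.2, h₂, d.adj⟩

theorem nonempty_of_induce_connected {s : Finset V} (hs : (G.induce (s : Set V)).Connected) :
    s.Nonempty := by
  obtain ⟨x⟩ := hs.nonempty
  exact ⟨x, x.2⟩

theorem induce_singleton_connected (x : V) :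
    (G.induce (({x} : Finset V) : Set V)).Connected := by
  rw [Finset.coe_singleton]
  have : Subsingleton ({x} : Set V) := Set.subsingleton_singleton.coe_sort
  have : Nonempty ({x} : Set V) := ⟨⟨x, rfl⟩⟩
  exact ⟨SimpleGraph.Preconnected.of_subsingleton⟩

theorem induce_insert_connected [DecidableEq V] {s : Finset V} (hs : (G.induce (s : Set V)).Connected)
    {a x : V} (ha : a ∈ s) (hax : G.Adj a x) :
    (G.induce ((insert x s : Finset V) : Set V)).Connected := by
  have h := SimpleGraph.induce_union_connected hs.preconnected
    (SimpleGraph.induce_pair_connected_of_adj hax).preconnected ⟨a, ha, by simp⟩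
  have e : (s : Set V) ∪ {a, x} = ((insert x s : Finset V) : Set V) := by
    ext z
    simp only [Set.mem_union, Finset.mem_coe, Set.mem_insert_iff, Set.mem_singleton_iff,
      Finset.coe_insert]
    constructor
    · rintro (h | rfl | h) <;> tauto
    · tauto
  rwa [e] at h

theorem induce_univ_connected [Fintype V] (hG : G.Connected) :
    (G.induce ((Finset.univ : Finset V) : Set V)).Connected := by
  rw [Finset.coe_univ]
  exact (SimpleGraph.induceUnivIso G).connected_iff.2 hG

theorem connectivity_le {W : Type*} [Fintype W] (H : SimpleGraph W) :
    connectivity H ≤ Fintype.card W - 1 :=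
  Nat.sInf_le (Or.inr rfl)

/-- Cores in different tubings are graphs on different subtypes; this compares them when their node
sets agree. -/
theorem connectivity_congr {A B : Finset V} (h : A = B) (H : SimpleGraph A) (K : SimpleGraph B)
    (hAdj : ∀ x y (hx : x ∈ A) (hy : y ∈ A) (hx' : x ∈ B) (hy' : y ∈ B),
      H.Adj ⟨x, hx⟩ ⟨y, hy⟩ ↔ K.Adj ⟨x, hx'⟩ ⟨y, hy'⟩) :
    connectivity H = connectivity K := by
  subst h
  congr 1
  ext ⟨x, hx⟩ ⟨y, hy⟩
  exact hAdj x y hx hy hx hy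

theorem IsTubing.subset [Fintype V] {T T' : Finset (Finset V)} (h : IsTubing G T') (hT : T ⊆ T') :
    IsTubing G T :=
  ⟨fun t ht => h.1 t (hT ht), fun s hs t ht => h.2 s (hT hs) t (hT ht)⟩

end Connectivity

/-! ### Cores of tubings and the effect of adding a tube. -/

section Tubings

variable {V : Type*} [Fintype V] [DecidableEq V] {G : SimpleGraph V}

theorem mem_coreNodes {T : Finset (Finset V)} {t : Finset V} {v : V} :
    v ∈ coreNodes T t ↔ v ∈ t ∧ ∀ s ∈ T, s ⊂ t → v ∉ s := by
  simp [coreNodes]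

theorem IsTubing.connected {T : Finset (Finset V)} (h : IsTubing G T) (hG : G.Connected)
    {s : Finset V} (hs : s ∈ insert Finset.univ T) : (G.induce (s : Set V)).Connected := by
  rcases Finset.mem_insert.1 hs with rfl | hs
  · exact induce_univ_connected hG
  · exact (h.1 s hs).2

/-- If the tubes below `s` covered `s`, an edge of the connected set `s` would leave a largest such
tube `m` and end in another one, `q`. Then `m ⊂ q` contradicts the choice of `m`, `q ⊂ m`
contradicts that the edge leaves `m`, and the edge itself rules out that they are apart. -/
theorem IsTubing.coreNodes_nonempty {T : Finset (Finset V)} (h : IsTubing G T)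
    (hG : G.Connected) {s : Finset V} (hs : s ∈ insert Finset.univ T) :
    (coreNodes T s).Nonempty := by
  by_contra hne
  rw [Finset.not_nonempty_iff_eq_empty] at hne
  have hcov : ∀ x ∈ s, ∃ r ∈ T, r ⊂ s ∧ x ∈ r := by
    intro x hx
    by_contra! hc
    have : x ∈ coreNodes T s := mem_coreNodes.2 ⟨hx, hc⟩
    simp [hne] at this
  have hsc := h.connected hG hs
  obtain ⟨x, hx⟩ := nonempty_of_induce_connected hsc
  obtain ⟨r, hr, hrs, -⟩ := hcov x hx
  obtain ⟨m, hm, hmax⟩ := Finset.exists_max_image (T.filter (· ⊂ s)) Finset.card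
    ⟨r, Finset.mem_filter.2 ⟨hr, hrs⟩⟩
  obtain ⟨hmT, hms⟩ := Finset.mem_filter.1 hm
  obtain ⟨a, ha, b, hb, hbm, hab⟩ := exists_adj_of_induce_connected hsc
    (nonempty_of_induce_connected (h.1 m hmT).2) hms
  obtain ⟨q, hq, hqs, hbq⟩ := hcov b hb
  rcases h.2 m hmT q hq (fun e => hbm (e ▸ hbq)) with hc | hc | ⟨-, hc⟩
  · exact (Finset.card_lt_card hc).not_ge (hmax q (Finset.mem_filter.2 ⟨hq, hqs⟩))
  · exact hbm (hc.1 hbq)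
  · exact hc a ha b hbq hab

/-- This leaves room in the core for one more color besides the outer blocks, so that inner blocks
never need negative size. -/
theorem outerCount_add_one_le {T : Finset (Finset V)} {s : Finset V}
    (h : (coreNodes T s).Nonempty) : outerCount G T s + 1 ≤ (coreNodes T s).card := by
  have h₁ := connectivity_le (core G T s)
  rw [Fintype.card_coe] at h₁
  have := h.card_pos
  unfold outerCount
  omega

/-- The smallest tube, possibly universal, that properly contains a given tube. -/
theorem IsTubing.exists_parent {T : Finset (Finset V)} (h : IsTubing G T) {t : Finset V}
    (ht : t ∈ T) : ∃ u ∈ insert Finset.univ T, t ⊂ u ∧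
      ∀ s ∈ insert Finset.univ T, t ⊂ s → u ⊆ s := by
  obtain ⟨u, hu, hmin⟩ := Finset.exists_min_image ((insert Finset.univ T).filter (t ⊂ ·))
    Finset.card ⟨Finset.univ, by simp [Finset.ssubset_univ_iff, (h.1 t ht).1]⟩
  obtain ⟨huT, htu⟩ := Finset.mem_filter.1 hu
  refine ⟨u, huT, htu, fun s hs hts => ?_⟩
  rcases Finset.mem_insert.1 hs with rfl | hsT
  · exact Finset.subset_univ _
  by_cases hus : u = s
  · exact hus.subset
  have hle := hmin s (Finset.mem_filter.2 ⟨hs, hts⟩)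
  rcases Finset.mem_insert.1 huT with rfl | huT
  · exact absurd (Finset.eq_univ_of_card s (le_antisymm (Finset.card_le_univ _) hle)).symm hus
  rcases h.2 u huT s hsT hus with hc | hc | ⟨hc, -⟩
  · exact hc.1
  · exact absurd (Finset.card_lt_card hc) hle.not_gt
  · obtain ⟨x, hx⟩ := nonempty_of_induce_connected (h.1 t ht).2
    exact absurd (hts.1 hx) (Finset.disjoint_left.1 hc (htu.1 hx))

section Insert

variable {T : Finset (Finset V)} {t u s : Finset V}

/-- A set `s ≠ u` above `t` lies strictly above `u`, and `u` already hides the nodes of `t`. -/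
theorem coreNodes_insert_of_ne (hu : u ∈ insert Finset.univ T)
    (htu : t ⊂ u) (hmin : ∀ s ∈ insert Finset.univ T, t ⊂ s → u ⊆ s)
    (hs : s ∈ insert Finset.univ T) (hsu : s ≠ u) :
    coreNodes (insert t T) s = coreNodes T s := by
  ext v
  simp only [mem_coreNodes, Finset.mem_insert, forall_eq_or_imp, and_congr_right_iff,
    and_iff_right_iff_imp]
  intro _ h hts hvt
  have hus : u ⊂ s := (hmin s hs hts).ssubset_of_ne hsu.symm
  rcases Finset.mem_insert.1 hu with rfl | hu
  · exact hus.2 (Finset.subset_univ _)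
  · exact h u hu hus (htu.1 hvt)

/-- A core edge that passes through `t` already passes through `u`. -/
theorem outerCount_insert_of_ne (hu : u ∈ insert Finset.univ T)
    (htu : t ⊂ u) (hmin : ∀ s ∈ insert Finset.univ T, t ⊂ s → u ⊆ s)
    (hs : s ∈ insert Finset.univ T) (hsu : s ≠ u) :
    outerCount G (insert t T) s = outerCount G T s := by
  unfold outerCount
  congr 1
  refine connectivity_congr (coreNodes_insert_of_ne hu htu hmin hs hsu) _ _ ?_
  intro x y hx hy hx' hy'
  simp only [core, ne_eq, Subtype.mk.injEq, Finset.mem_insert, exists_eq_or_imp,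
    and_congr_right_iff]
  intro _
  refine or_congr_right ⟨?_, Or.inr⟩
  rintro (⟨hts, ⟨a, ha, hxa⟩, b, hb, hyb⟩ | h)
  · have hus : u ⊂ s := (hmin s hs hts).ssubset_of_ne hsu.symm
    rcases Finset.mem_insert.1 hu with rfl | hu
    · exact absurd (Finset.subset_univ _) hus.2
    · exact ⟨u, hu, hus, ⟨a, htu.1 ha, hxa⟩, b, htu.1 hb, hyb⟩
  · exact h

/-- The old core of `u` splits by membership in `t`. By minimality of `u` no tube strictly between
`t` and `u` hides nodes of `t`. -/
theorem card_coreNodes_insert (hT : IsTubing G (insert t T)) (ht : t ∉ T)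
    (htu : t ⊂ u) (hmin : ∀ s ∈ insert Finset.univ T, t ⊂ s → u ⊆ s) :
    (coreNodes T u).card = (coreNodes (insert t T) u).card + (coreNodes (insert t T) t).card := by
  rw [← Finset.card_union_of_disjoint]
  · congr 1
    ext v
    simp only [Finset.mem_union, mem_coreNodes, Finset.mem_insert, forall_eq_or_imp]
    constructor
    · rintro ⟨hv, h⟩
      by_cases hvt : v ∈ t
      · exact Or.inr ⟨hvt, fun h => absurd h (ssubset_irrefl t),
          fun r hr hrt => h r hr (hrt.trans htu)⟩
      · exact Or.inl ⟨hv, fun _ => hvt, h⟩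
    · rintro (⟨hv, -, h⟩ | ⟨hv, -, h⟩)
      · exact ⟨hv, h⟩
      · refine ⟨htu.1 hv, fun r hr hru hvr => ?_⟩
        rcases hT.2 r (Finset.mem_insert_of_mem hr) t (Finset.mem_insert_self _ _)
          (fun e => ht (e ▸ hr)) with hc | hc | ⟨hc, -⟩
        · exact h r hr hc hvr
        · exact hru.2 (hmin r (Finset.mem_insert_of_mem hr) hc)
        · exact Finset.disjoint_left.1 hc hvr hv
  · rw [Finset.disjoint_left]
    intro v hv hv'
    exact (mem_coreNodes.1 hv).2 t (Finset.mem_insert_self _ _) htu (mem_coreNodes.1 hv').1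

end Insert

end Tubings

/-! ### Existence and uniqueness of templates below a given one. -/

namespace ColorTemplate

variable {V : Type*} [Fintype V] [DecidableEq V] {C : Type*} {G : SimpleGraph V}
  {palette : Multiset C}

/-- The extra summand stands for the missing own color of the universal tube, so that all tubes obey
one formula. -/
theorem length_ordered_add (Q : ColorTemplate G palette) {s : Finset V}
    (hs : s ∈ insert Finset.univ Q.tubing) :
    (Q.ordered s).length + (if s = Finset.univ then 1 else 0) =
      1 + outerCount G Q.tubing s := by
  split_ifs with h
  · subst h
    rw [Q.length_ordered_univ, add_comm]
  · rw [add_zero, Q.length_ordered s ((Finset.mem_insert.1 hs).resolve_left h)]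

theorem card_colors_add (Q : ColorTemplate G palette) {s : Finset V}
    (hs : s ∈ insert Finset.univ Q.tubing) :
    (Q.ordered s).length + (Q.inner s).card + (if s = Finset.univ then 1 else 0) =
      (coreNodes Q.tubing s).card := by
  split_ifs with h
  · subst h
    rw [Q.card_inner_univ]
  · rw [add_zero, Q.card_inner s ((Finset.mem_insert.1 hs).resolve_left h)]

/-- Every tube uses up at least its own color. -/
theorem card_tubing_lt (Q : ColorTemplate G palette) (hpal : palette.card + 1 = Fintype.card V) :
    Q.tubing.card < Fintype.card V := by
  have h := congrArg Multiset.card Q.partition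
  rw [Multiset.card_sum] at h
  have h₁ : ∑ t ∈ Q.tubing, 1 ≤ ∑ t ∈ insert Finset.univ Q.tubing,
      Multiset.card ((Q.ordered t : Multiset C) + Q.inner t) := by
    refine (Finset.sum_le_sum fun t ht => ?_).trans
      (Finset.sum_le_sum_of_subset (Finset.subset_insert _ _))
    have := Q.length_ordered t ht
    simp only [Multiset.card_add, Multiset.coe_card]
    omega
  rw [Finset.sum_const, smul_eq_mul, mul_one] at h₁
  omega

/-- The colors of the parent `u`, in any admissible order, are cut into a part for `u` and a part
for `t`, and each part into ordered and inner colors. The lengths fit by `card_coreNodes_insert`. -/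
theorem exists_step (hG : G.Connected) (Q : ColorTemplate G palette) {t : Finset V}
    (ht : t ∉ Q.tubing) (hT : IsTubing G (insert t Q.tubing)) :
    ∃ P : ColorTemplate G palette, Step P Q ∧ P.tubing = insert t Q.tubing := by
  obtain ⟨u, hu, htu, hmin⟩ := hT.exists_parent (Finset.mem_insert_self t _)
  have hsub : insert Finset.univ Q.tubing ⊆ insert Finset.univ (insert t Q.tubing) :=
    Finset.insert_subset_insert _ (Finset.subset_insert _ _)
  have hmin' : ∀ s ∈ insert Finset.univ Q.tubing, t ⊂ s → u ⊆ s := fun s hs => hmin s (hsub hs)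
  have hut : u ≠ t := fun e => htu.ne e.symm
  have huQ : u ∈ insert Finset.univ Q.tubing := by
    simp only [Finset.mem_insert] at hu ⊢
    tauto
  have htuniv : t ≠ Finset.univ := (hT.1 t (Finset.mem_insert_self _ _)).1
  have htQ : t ∉ insert Finset.univ Q.tubing := by simp [ht, htuniv]
  have hcard := card_coreNodes_insert hT ht htu hmin'
  have hou := outerCount_add_one_le (G := G) (hT.coreNodes_nonempty hG hu)
  have hot := outerCount_add_one_le (G := G) (hT.coreNodes_nonempty hG
    (Finset.mem_insert_of_mem (Finset.mem_insert_self t _)))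
  have hQc := Q.card_colors_add huQ
  set T' := insert t Q.tubing with hT'
  -- The universal tube has no own color, hence one color fewer than its core has nodes.
  set ε : ℕ := if u = Finset.univ then 1 else 0 with hε
  have hε1 : ε ≤ 1 := by rw [hε]; split_ifs <;> omega
  set l := (Q.inner u).toList with hl
  have hll : (l : Multiset C) = Q.inner u := Multiset.coe_toList _
  have hlen : l.length = (Q.inner u).card := Multiset.length_toList _
  set L := Q.ordered u ++ l with hL
  have hLlen : L.length + ε = (coreNodes Q.tubing u).card := by
    rw [hL, List.length_append, hlen, hQc]
  set A := L.take ((coreNodes T' u).card - ε) with hA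
  set B := L.drop ((coreNodes T' u).card - ε) with hB
  have hAB : A ++ B = L := List.take_append_drop _ _
  have hAlen : A.length + ε = (coreNodes T' u).card := by
    rw [hA, List.length_take]; omega
  have hBlen : B.length = (coreNodes T' t).card := by
    rw [hB, List.length_drop]; omega
  set a := 1 + outerCount G T' u - ε with ha
  set b := 1 + outerCount G T' t with hb
  have hLQ : (L : Multiset C) = (Q.ordered u : Multiset C) + Q.inner u := by
    rw [hL, ← Multiset.coe_add, hll]
  let ord : Finset V → List C :=
    Function.update (Function.update Q.ordered u (A.take a)) t (B.take b)
  let inn : Finset V → Multiset C :=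
    Function.update (Function.update Q.inner u (A.drop a : Multiset C)) t
      (B.drop b : Multiset C)
  have ordt : ord t = B.take b := by simp [ord]
  have innt : inn t = (B.drop b : Multiset C) := by simp [inn]
  have ordu : ord u = A.take a := by simp [ord, hut]
  have innu : inn u = (A.drop a : Multiset C) := by simp [inn, hut]
  have ords : ∀ s, s ≠ t → s ≠ u → ord s = Q.ordered s := fun s h₁ h₂ => by simp [ord, h₁, h₂]
  have inns : ∀ s, s ≠ t → s ≠ u → inn s = Q.inner s := fun s h₁ h₂ => by simp [inn, h₁, h₂]
  have key₁ : ∀ s ∈ insert Finset.univ T', (ord s).length + (if s = Finset.univ then 1 else 0) =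
      1 + outerCount G T' s := by
    intro s hs
    by_cases hst : s = t
    · subst hst
      rw [ordt, if_neg htuniv, List.length_take]
      omega
    by_cases hsu : s = u
    · subst hsu
      rw [ordu, ← hε, List.length_take]
      omega
    have hsQ : s ∈ insert Finset.univ Q.tubing := by
      simp only [hT', Finset.mem_insert] at hs ⊢
      tauto
    rw [ords s hst hsu, Q.length_ordered_add hsQ,
      outerCount_insert_of_ne huQ htu hmin' hsQ hsu]
  have key₂ : ∀ s ∈ insert Finset.univ T', (ord s).length + (inn s).card +
      (if s = Finset.univ then 1 else 0) = (coreNodes T' s).card := by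
    intro s hs
    by_cases hst : s = t
    · subst hst
      rw [ordt, innt, if_neg htuniv, Multiset.coe_card, ← List.length_append,
        List.take_append_drop]
      omega
    by_cases hsu : s = u
    · subst hsu
      rw [ordu, innu, ← hε, Multiset.coe_card, ← List.length_append, List.take_append_drop]
      omega
    have hsQ : s ∈ insert Finset.univ Q.tubing := by
      simp only [hT', Finset.mem_insert] at hs ⊢
      tauto
    rw [ords s hst hsu, inns s hst hsu, Q.card_colors_add hsQ,
      coreNodes_insert_of_ne huQ htu hmin' hsQ hsu]
  have hne : ∀ s ∉ insert Finset.univ T', s ≠ t ∧ s ≠ u ∧ s ∉ insert Finset.univ Q.tubing :=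
    fun s hs => ⟨fun e => hs (by simp [e, hT']), fun e => hs (e ▸ hu), fun h => hs (hsub h)⟩
  have hTu : ∀ s ∈ T', s ≠ Finset.univ := fun s hs => (hT.1 s hs).1
  refine ⟨⟨T', hT, ord, inn, ?_, ?_, ?_, ?_, ?_, ?_, ?_⟩, ⟨t, u, ht, rfl, hu, htu, hmin,
    fun s h₁ h₂ => ⟨ords s h₁ h₂, inns s h₁ h₂⟩, l, A.drop a, B.drop b, hll, innu.symm,
    innt.symm, ?_⟩, rfl⟩
  · intro s hs
    obtain ⟨h₁, h₂, h₃⟩ := hne s hs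
    rw [ords s h₁ h₂, Q.ordered_off s h₃]
  · intro s hs
    obtain ⟨h₁, h₂, h₃⟩ := hne s hs
    rw [inns s h₁ h₂, Q.inner_off s h₃]
  · intro s hs
    simpa [hTu s hs] using key₁ s (Finset.mem_insert_of_mem hs)
  · intro s hs
    simpa [hTu s hs] using key₂ s (Finset.mem_insert_of_mem hs)
  · have := key₁ _ (Finset.mem_insert_self _ _)
    rw [if_pos rfl] at this
    omega
  · have := key₂ _ (Finset.mem_insert_self _ _)
    rwa [if_pos rfl] at this
  · refine Eq.trans ?_ Q.partition
    rw [hT', Finset.insert_comm, Finset.sum_insert htQ, ← Finset.add_sum_erase _ _ huQ,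
      ← Finset.add_sum_erase _ _ huQ, ordt, innt, ordu, innu, Multiset.coe_add,
      Multiset.coe_add, List.take_append_drop, List.take_append_drop, ← add_assoc,
      Multiset.coe_add, ← hLQ, ← hAB]
    refine congrArg₂ (· + ·) (Multiset.coe_eq_coe.2 List.perm_append_comm) ?_
    refine Finset.sum_congr rfl fun s hs => ?_
    obtain ⟨h₁, h₂⟩ := Finset.mem_erase.1 hs
    have hst : s ≠ t := fun e => htQ (e ▸ h₂)
    rw [ords s hst h₁, inns s hst h₁]
  · change L = (ord u ++ _) ++ (ord t ++ _)
    rw [ordt, ordu, List.take_append_drop, List.take_append_drop, hAB]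

theorem exists_le (hG : G.Connected) (Q : ColorTemplate G palette) (T : Finset (Finset V))
    (hT : IsTubing G T) (hQ : Q.tubing ⊆ T) :
    ∃ P : ColorTemplate G palette, P ≤ Q ∧ P.tubing = T := by
  obtain ⟨S, rfl⟩ : ∃ S, T = S ∪ Q.tubing := ⟨T, (Finset.union_eq_left.2 hQ).symm⟩
  clear hQ
  induction S using Finset.induction_on with
  | empty => exact ⟨Q, le_rfl, by simp⟩
  | insert t S ht ih =>
    rw [Finset.insert_union] at hT ⊢
    obtain ⟨P, hPQ, hP⟩ := ih (hT.subset (Finset.subset_insert _ _))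
    by_cases htP : t ∈ S ∪ Q.tubing
    · exact ⟨P, hPQ, by rw [Finset.insert_eq_of_mem htP, hP]⟩
    · rw [← hP] at htP hT ⊢
      obtain ⟨R, hR, hRT⟩ := exists_step hG P htP hT
      exact ⟨R, (Relation.ReflTransGen.single hR).trans hPQ, hRT⟩

theorem tubing_ssubset_of_lt {P Q : ColorTemplate G palette} (h : P < Q) :
    Q.tubing ⊂ P.tubing := by
  rcases Relation.ReflTransGen.cases_head h.le with e | ⟨R, hPR, hRQ⟩
  · exact absurd e h.ne
  · exact (subset_of_reflTransGen hRQ).trans_ssubset hPR.ssubset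

theorem Step.lt {P Q : ColorTemplate G palette} (h : Step P Q) : P < Q :=
  lt_of_le_of_ne (Relation.ReflTransGen.single h) fun e => h.ssubset.ne (e ▸ rfl)

theorem covBy_iff_step {P Q : ColorTemplate G palette} : P ⋖ Q ↔ Step P Q := by
  constructor
  · intro h
    rcases Relation.ReflTransGen.cases_tail h.le with e | ⟨R, hPR, hRQ⟩
    · exact absurd e.symm h.ne
    · rcases eq_or_lt_of_le (show P ≤ R from hPR) with rfl | hlt
      · exact hRQ
      · exact absurd hRQ.lt (h.2 hlt)
  · intro h
    refine ⟨h.lt, fun R h₁ h₂ => ?_⟩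
    obtain ⟨t, -, ht, e, -⟩ := h
    have c₁ := Finset.card_lt_card (tubing_ssubset_of_lt h₁)
    have c₂ := Finset.card_lt_card (tubing_ssubset_of_lt h₂)
    rw [e, Finset.card_insert_of_notMem ht] at c₁
    omega

/-- If all cores have at most two nodes, then a template covered is determined by the tube that
is added. -/
theorem Step.eq_of_tubing_eq {P P' Q : ColorTemplate G palette} (h : Step P Q) (h' : Step P' Q)
    (e : P.tubing = P'.tubing)
    (hQ : ∀ s ∈ insert Finset.univ Q.tubing, (coreNodes Q.tubing s).card ≤ 2) : P = P' := by
  obtain ⟨t, u, ht, hP, hu, htu, hmin, hs, l, l₁, l₂, hl, hl₁, hl₂, hL⟩ := h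
  obtain ⟨t', u', ht', hP', hu', htu', hmin', hs', l', l₁', l₂', hl', hl₁', hl₂', hL'⟩ := h'
  obtain rfl : t = t' := by
    have : t ∈ P'.tubing := by rw [← e, hP]; exact Finset.mem_insert_self _ _
    rw [hP'] at this
    exact (Finset.mem_insert.1 this).resolve_right ht
  rw [e] at hu hmin
  obtain rfl : u = u' := (hmin _ hu' htu').antisymm (hmin' _ hu htu)
  have hut : u ≠ t := fun e => htu.ne e.symm
  have huQ : u ∈ insert Finset.univ Q.tubing := by
    rw [hP'] at hu
    simp only [Finset.mem_insert] at hu ⊢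
    tauto
  have htP' : t ∈ insert Finset.univ P'.tubing := by simp [hP']
  -- An own color, or its absence for the universal tube, accounts for one node of the core. At most
  -- one color is left for the inner block, so its listing `l` is forced.
  have hinner : (Q.inner u).card ≤ 1 := by
    have h₁ := Q.card_colors_add huQ
    have h₂ := Q.length_ordered_add huQ
    have h₃ := hQ u huQ
    split_ifs at h₁ h₂ <;> omega
  obtain rfl : l = l' := by
    have hp : l.Perm l' := Multiset.coe_eq_coe.1 (hl.trans hl'.symm)
    have hlen : l.length ≤ 1 := by rw [← Multiset.coe_card, hl]; exact hinner
    rcases l with _ | ⟨x, _ | ⟨y, l⟩⟩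
    · exact (List.nil_perm.1 hp).symm
    · exact (List.perm_singleton.1 hp.symm).symm
    · simp at hlen
  -- Block lengths depend on the tubing only, so the two equal concatenations split at the same
  -- places.
  have hlo : ∀ s ∈ insert Finset.univ P'.tubing,
      (P.ordered s).length = (P'.ordered s).length := by
    intro s hs
    have h₁ := P.length_ordered_add (e ▸ hs)
    have h₂ := P'.length_ordered_add hs
    rw [e] at h₁
    omega
  have hli : ∀ s ∈ insert Finset.univ P'.tubing, (P.inner s).card = (P'.inner s).card := by
    intro s hs
    have h₁ := P.card_colors_add (e ▸ hs)
    have h₂ := P'.card_colors_add hs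
    have h₃ := hlo s hs
    rw [e] at h₁
    omega
  have hlen₁ : l₁.length = l₁'.length := by
    rw [← Multiset.coe_card, ← Multiset.coe_card, hl₁, hl₁', hli u hu]
  have hlen₂ : l₂.length = l₂'.length := by
    rw [← Multiset.coe_card, ← Multiset.coe_card, hl₂, hl₂', hli t htP']
  rw [hL] at hL'
  obtain ⟨hA, hB⟩ := List.append_inj hL' (by simp [hlo u hu, hlen₁])
  obtain ⟨ou, rfl⟩ := List.append_inj hA (hlo u hu)
  obtain ⟨ot, rfl⟩ := List.append_inj hB (hlo t htP')
  refine ColorTemplate.ext e (funext fun s => ?_) (funext fun s => ?_)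
  all_goals
    by_cases hst : s = t
    · subst hst
      first | exact ot | exact hl₂.symm.trans hl₂'
    by_cases hsu : s = u
    · subst hsu
      first | exact ou | exact hl₁.symm.trans hl₁'
  · rw [(hs s hst hsu).1, (hs' s hst hsu).1]
  · rw [(hs s hst hsu).2, (hs' s hst hsu).2]

end ColorTemplate

/-! ### Heights, covers and regularity. -/

section Flags

variable {V : Type*} [Fintype V] [DecidableEq V] {C : Type*} {G : SimpleGraph V}
  {palette : Multiset C}

open ColorTemplate

/-- The rank of a face of the associahedron: the number of nodes minus the number of tubes. -/
def faceRank (P₀ : TopTemplate G palette) : Associahedron G palette P₀ → ℕ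
  | ⊥ => 0
  | (Q : Set.Iic P₀.1) => Fintype.card V - Q.1.tubing.card

/-- By `card_tubing_lt` templates have positive rank, hence lie above the value at `⊥`. -/
theorem faceRank_strictMono (hpal : palette.card + 1 = Fintype.card V)
    (P₀ : TopTemplate G palette) : StrictMono (faceRank P₀) := by
  intro X Y h
  induction Y using WithBot.recBotCoe with
  | bot => exact absurd h not_lt_bot
  | coe Q =>
    have hQ := Q.1.card_tubing_lt hpal
    induction X using WithBot.recBotCoe with
    | bot =>
      change 0 < Fintype.card V - Q.1.tubing.card
      omega
    | coe P =>
      have hP := P.1.card_tubing_lt hpal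
      have hPQ : P < Q := WithBot.coe_lt_coe.1 h
      have := Finset.card_lt_card (tubing_ssubset_of_lt (show P.1 < Q.1 from hPQ))
      change Fintype.card V - P.1.tubing.card < Fintype.card V - Q.1.tubing.card
      omega

/-- A template below `P₀` as a face of the associahedron. -/
def face (P₀ : TopTemplate G palette) (F : ColorTemplate G palette) (hF : F ≤ P₀.1) :
    Associahedron G palette P₀ :=
  ((⟨F, hF⟩ : Set.Iic P₀.1) : WithBot (Set.Iic P₀.1))

theorem face_lt_face {P₀ : TopTemplate G palette} {P Q : ColorTemplate G palette} {hP : P ≤ P₀.1}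
    {hQ : Q ≤ P₀.1} : face P₀ P hP < face P₀ Q hQ ↔ P < Q :=
  WithBot.coe_lt_coe

/-- Height three is dimension two, since `⊥` counts. The bound above is `faceRank`; the bound below
is the chain `⊥ < P < E < F`. -/
theorem height_face_eq_three (hpal : palette.card + 1 = Fintype.card V)
    (P₀ : TopTemplate G palette) {P E F : ColorTemplate G palette} (hF : F ≤ P₀.1)
    (hPE : P < E) (hEF : E < F) (hcard : F.tubing.card + 3 = Fintype.card V) :
    Order.height (face P₀ F hF) = 3 := by
  apply le_antisymm
  · have h := Order.height_le_height_apply_of_strictMono _ (faceRank_strictMono hpal P₀)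
      (face P₀ F hF)
    rw [Order.height_nat] at h
    refine h.trans ?_
    have : faceRank P₀ (face P₀ F hF) = 3 := by
      change Fintype.card V - F.tubing.card = 3
      omega
    rw [this]
    rfl
  · have hE := hEF.le.trans hF
    have hP := hPE.le.trans hE
    have h₁ : (⊥ : Associahedron G palette P₀) < face P₀ P hP := WithBot.bot_lt_coe _
    have h₂ : face P₀ P hP < face P₀ E hE := face_lt_face.2 hPE
    have h₃ : face P₀ E hE < face P₀ F hF := face_lt_face.2 hEF
    calc (3 : ℕ∞) = 0 + 1 + 1 + 1 := by norm_num
      _ ≤ Order.height (⊥ : Associahedron G palette P₀) + 1 + 1 + 1 := by gcongr; exact zero_le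
      _ ≤ Order.height (face P₀ P hP) + 1 + 1 := by gcongr; exact Order.height_add_one_le h₁
      _ ≤ Order.height (face P₀ E hE) + 1 := by gcongr; exact Order.height_add_one_le h₂
      _ ≤ _ := Order.height_add_one_le h₃

theorem face_covBy_face {P₀ : TopTemplate G palette} {P F : ColorTemplate G palette}
    {hP : P ≤ P₀.1} {hF : F ≤ P₀.1} : face P₀ P hP ⋖ face P₀ F hF ↔ Step P F := by
  rw [← covBy_iff_step]
  unfold face
  rw [WithBot.coe_covBy_coe]
  constructor
  · intro h
    exact ⟨h.1, fun R h₁ h₂ => h.2 (c := ⟨R, h₂.le.trans hF⟩) h₁ h₂⟩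
  · intro h
    exact ⟨h.1, fun R h₁ h₂ => h.2 (c := R.1) h₁ h₂⟩

/-- The template `E` between `⊥` and `F` keeps `⊥` from being among the covered faces. -/
theorem encard_covBy_face (P₀ : TopTemplate G palette) {E F : ColorTemplate G palette}
    (hF : F ≤ P₀.1) (hEF : E < F) :
    {X | X ⋖ face P₀ F hF}.encard = {P | Step P F}.encard := by
  let f : {P | Step P F} → {X | X ⋖ face P₀ F hF} := fun P =>
    ⟨face P₀ P.1 ((Step.lt P.2).le.trans hF), face_covBy_face.2 P.2⟩
  refine (Set.encard_congr (Equiv.ofBijective f ⟨?_, ?_⟩)).symm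
  · intro P Q h
    have h' : face P₀ P.1 _ = face P₀ Q.1 _ := congrArg Subtype.val h
    have h'' := WithBot.coe_injective h'
    exact Subtype.ext (Subtype.mk.inj h'')
  · rintro ⟨X, hX⟩
    induction X using WithBot.recBotCoe with
    | bot =>
      exact absurd (face_lt_face (hP := hEF.le.trans hF).2 hEF) (hX.2 (WithBot.bot_lt_coe _))
    | coe P => exact ⟨⟨P.1, (face_covBy_face (hP := P.2)).1 hX⟩, rfl⟩

theorem exists_flag_mem {A : Type*} [PartialOrder A] (x : A) : ∃ Φ : Flag A, x ∈ Φ := by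
  obtain ⟨M, hM, hx⟩ := (IsChain.singleton (r := (· ≤ ·)) (a := x)).exists_maxChain
  exact ⟨Flag.ofIsMaxChain M hM, hx rfl⟩

/-- In a regular poset, faces of the same finite height cover equally many faces. -/
theorem IsRegular.encard_covBy_eq {A : Type*} [PartialOrder A] (h : IsRegular A) {x y : A}
    (hxy : Order.height x = Order.height y) (hfin : Order.height x < ⊤) :
    {z | z ⋖ x}.encard = {z | z ⋖ y}.encard := by
  obtain ⟨Φ, hΦ⟩ := exists_flag_mem x
  obtain ⟨Ψ, hΨ⟩ := exists_flag_mem y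
  obtain ⟨σ, rfl⟩ := h Φ Ψ
  have hσ : σ x ∈ Flag.map σ Φ := by
    rw [← SetLike.mem_coe, Flag.coe_map]
    exact ⟨x, hΦ, rfl⟩
  have hh : Order.height (σ x) = Order.height y := by rw [Order.height_orderIso, hxy]
  -- Both elements lie in one flag, hence are comparable; comparable elements of the same finite
  -- height coincide.
  have he : σ x = y := by
    rcases (Flag.map σ Φ).le_or_le hσ hΨ with hle | hle
    · by_contra hne
      exact (Order.height_strictMono (hle.lt_of_ne hne)
        (by rw [Order.height_orderIso]; exact hfin)).ne hh
    · by_contra hne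
      exact (Order.height_strictMono (hle.lt_of_ne (Ne.symm hne)) (hxy ▸ hfin)).ne hh.symm
  subst he
  refine Set.encard_congr (σ.toEquiv.subtypeEquiv fun z => ?_)
  exact (apply_covBy_apply_iff σ).symm

end Flags

/-! ### A chain of connected sets and the tubes compatible with parts of it. -/

section Chain

variable {V : Type*} [Fintype V] [DecidableEq V] {G : SimpleGraph V}

/-- `t 0 ⊂ t 1 ⊂ ⋯` is a maximal chain of connected node sets, where `t i` has `i + 1` nodes and
`x i` is the node of `t i` that is not in the previous set. -/
structure IsConnectedChain (G : SimpleGraph V) (t : ℕ → Finset V) (x : ℕ → V) : Prop where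
  zero : t 0 = {x 0}
  succ : ∀ i, i + 1 < Fintype.card V → t (i + 1) = insert (x (i + 1)) (t i)
  notMem : ∀ i, i + 1 < Fintype.card V → x (i + 1) ∉ t i
  adj : ∀ i, i + 1 < Fintype.card V → ∃ a ∈ t i, G.Adj a (x (i + 1))

/-- Greedy growth: by connectedness a nonempty proper subset has a neighbor outside it. -/
theorem exists_isConnectedChain (hG : G.Connected) : ∃ t x, IsConnectedChain G t x := by
  have hy : ∀ s : Finset V, ∃ y, s.Nonempty → s ≠ Finset.univ →
      y ∉ s ∧ ∃ a ∈ s, G.Adj a y := by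
    intro s
    obtain ⟨z⟩ := hG.nonempty
    by_cases hs : s.Nonempty ∧ s ≠ Finset.univ
    · obtain ⟨a, ha, b, -, hb, hab⟩ := exists_adj_of_induce_connected
        (induce_univ_connected hG) hs.1 (Finset.ssubset_univ_iff.2 hs.2)
      exact ⟨b, fun _ _ => ⟨hb, a, ha, hab⟩⟩
    · exact ⟨z, fun h₁ h₂ => absurd ⟨h₁, h₂⟩ hs⟩
  choose y hy using hy
  obtain ⟨z⟩ := hG.nonempty
  let t : ℕ → Finset V := fun i => (fun s => insert (y s) s)^[i] {z}
  have ht : ∀ i, t (i + 1) = insert (y (t i)) (t i) := fun i =>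
    Function.iterate_succ_apply' (fun s => insert (y s) s) i {z}
  -- Only an upper bound holds for all `i`: once everything is exhausted, the inserted node is an
  -- old one.
  have hle : ∀ i, (t i).Nonempty ∧ (t i).card ≤ i + 1 := by
    intro i
    induction i with
    | zero => simp [t]
    | succ i ih =>
      rw [ht]
      exact ⟨Finset.insert_nonempty _ _, (Finset.card_insert_le _ _).trans (by omega)⟩
  have hne : ∀ i, i + 1 < Fintype.card V → t i ≠ Finset.univ := by
    intro i hi e
    have := (hle i).2
    rw [e, Finset.card_univ] at this
    omega
  refine ⟨t, fun i => Nat.casesOn i z fun j => y (t j), rfl, fun i _ => ht i,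
    fun i hi => (hy _ (hle i).1 (hne i hi)).1, fun i hi => (hy _ (hle i).1 (hne i hi)).2⟩

namespace IsConnectedChain

variable {t : ℕ → Finset V} {x : ℕ → V} (h : IsConnectedChain G t x)

include h

theorem card_eq {i : ℕ} (hi : i < Fintype.card V) : (t i).card = i + 1 := by
  induction i with
  | zero => simp [h.zero]
  | succ i ih => rw [h.succ i hi, Finset.card_insert_of_notMem (h.notMem i hi), ih (by omega)]

theorem connected {i : ℕ} (hi : i < Fintype.card V) : (G.induce (t i : Set V)).Connected := by
  induction i with
  | zero => rw [h.zero]; exact induce_singleton_connected _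
  | succ i ih =>
    rw [h.succ i hi]
    obtain ⟨a, ha, hax⟩ := h.adj i hi
    exact induce_insert_connected (ih (by omega)) ha hax

theorem subset {i j : ℕ} (hij : i ≤ j) (hj : j < Fintype.card V) : t i ⊆ t j := by
  induction j, hij using Nat.le_induction with
  | base => exact Finset.Subset.refl _
  | succ j _ ih =>
    rw [h.succ j hj]
    exact (ih (by omega)).trans (Finset.subset_insert _ _)

theorem ssubset {i j : ℕ} (hij : i < j) (hj : j < Fintype.card V) : t i ⊂ t j := by
  refine (h.subset hij.le hj).ssubset_of_ne fun e => ?_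
  have := h.card_eq (hij.trans hj)
  rw [e, h.card_eq hj] at this
  omega

theorem injOn {I : Finset ℕ} (hI : ∀ i ∈ I, i < Fintype.card V) : Set.InjOn t I := by
  intro i hi j hj e
  have := h.card_eq (hI i hi)
  rw [e, h.card_eq (hI j hj)] at this
  omega

theorem eq_univ {i : ℕ} (hi : i + 1 = Fintype.card V) : t i = Finset.univ :=
  Finset.eq_univ_of_card _ (by rw [h.card_eq (by omega), hi])

theorem ne_univ {i : ℕ} (hi : i + 1 < Fintype.card V) : t i ≠ Finset.univ := by
  intro e
  have := h.card_eq (i := i) (by omega)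
  rw [e, Finset.card_univ] at this
  omega

theorem isTubing {I : Finset ℕ} (hI : ∀ i ∈ I, i + 1 < Fintype.card V) :
    IsTubing G (I.image t) := by
  constructor
  · intro s hs
    obtain ⟨i, hi, rfl⟩ := Finset.mem_image.1 hs
    exact ⟨h.ne_univ (hI i hi), h.connected (by have := hI i hi; omega)⟩
  · intro s hs r hr hne
    obtain ⟨i, hi, rfl⟩ := Finset.mem_image.1 hs
    obtain ⟨j, hj, rfl⟩ := Finset.mem_image.1 hr
    have := hI i hi
    have := hI j hj
    rcases lt_trichotomy i j with hij | rfl | hij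
    · exact Or.inl (h.ssubset hij (by omega))
    · exact absurd rfl hne
    · exact Or.inr (Or.inl (h.ssubset hij (by omega)))

theorem isTubing_insert {I : Finset ℕ} (hI : ∀ i ∈ I, i + 1 < Fintype.card V) {s : Finset V}
    (hs : (G.induce (s : Set V)).Connected) (hsI : ∀ i ∈ I, s ⊂ t i) (hne : s ≠ Finset.univ) :
    IsTubing G (insert s (I.image t)) := by
  have hT := h.isTubing hI
  constructor
  · intro r hr
    rcases Finset.mem_insert.1 hr with rfl | hr
    · exact ⟨hne, hs⟩
    · exact hT.1 r hr
  · intro r hr q hq hrq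
    rcases Finset.mem_insert.1 hr with e₁ | hr' <;> rcases Finset.mem_insert.1 hq with e₂ | hq'
    · exact absurd (e₁.trans e₂.symm) hrq
    · obtain ⟨i, hi, rfl⟩ := Finset.mem_image.1 hq'
      exact Or.inl (e₁ ▸ hsI i hi)
    · obtain ⟨i, hi, rfl⟩ := Finset.mem_image.1 hr'
      exact Or.inr (Or.inl (e₂ ▸ hsI i hi))
    · exact hT.2 r hr' q hq' hrq

/-- A tube that is compatible with all of `t k, t (k + 1), …` is contained in `t k`. -/
theorem ssubset_of_compatible {k : ℕ} (hk : k < Fintype.card V) {s : Finset V} (hs : IsTube G s)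
    (hne : ∀ j, k ≤ j → j + 1 < Fintype.card V → s ≠ t j ∧ Compatible G s (t j)) :
    s ⊂ t k := by
  -- Downward induction on `k`, starting at `t k = univ`. A tube inside `t (k + 1)` cannot lie
  -- strictly between `t k` and `t (k + 1)`, and cannot be apart from `t k`, because `x (k + 1)` has
  -- a neighbor there.
  obtain ⟨m, hm⟩ : ∃ m, k + m + 1 = Fintype.card V := ⟨Fintype.card V - k - 1, by omega⟩
  induction m generalizing k with
  | zero =>
    rw [h.eq_univ hm]
    exact Finset.ssubset_univ_iff.2 hs.1
  | succ m ih =>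
    have hk' : k + 1 < Fintype.card V := by omega
    have hs' := ih hk' (fun j hj => hne j (by omega)) (by omega)
    obtain ⟨-, hc⟩ := hne k le_rfl hk'
    rcases hc with hc | hc | ⟨hd, hadj⟩
    · exact hc
    · have h₁ := Finset.card_lt_card hc
      have h₂ := Finset.card_lt_card hs'
      rw [h.card_eq hk] at h₁
      rw [h.card_eq hk'] at h₂
      omega
    · exfalso
      obtain ⟨z, hz⟩ := nonempty_of_induce_connected hs.2
      have hz' := hs'.1 hz
      rw [h.succ k hk'] at hz'
      rcases Finset.mem_insert.1 hz' with rfl | hz'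
      · obtain ⟨a, ha, hax⟩ := h.adj k hk'
        exact hadj _ hz a ha hax.symm
      · exact Finset.disjoint_left.1 hd hz hz'

theorem t_one (hn : 4 ≤ Fintype.card V) : t 1 = {x 1, x 0} := by
  rw [h.succ 0 (by omega), h.zero]

theorem t_two (hn : 4 ≤ Fintype.card V) : t 2 = {x 2, x 1, x 0} := by
  rw [h.succ 1 (by omega), h.t_one hn]

/-- The tubes compatible with all of `t 1, t 3, t 4, …`. -/
theorem exists_candidates (hn : 4 ≤ Fintype.card V) : ∃ D : Finset (Finset V), D.card ≤ 4 ∧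
    ∀ s, IsTube G s → (∀ j, j = 1 ∨ 3 ≤ j → j + 1 < Fintype.card V →
      s ≠ t j ∧ Compatible G s (t j)) → s ∈ D := by
  classical
  -- The tube lies strictly inside `t 3`. Within `t 1` it is a singleton; around `t 1` it adds `x 2`
  -- or `x 3`; apart from `t 1` it is `{x 3}`, as `x 2` has a neighbor in `t 1`. The two options
  -- with `x 3` but without `x 2` exclude each other, which keeps the count at four.
  refine ⟨{{x 0}, {x 1}, t 2, if ∃ a ∈ t 1, G.Adj a (x 3) then insert (x 3) (t 1) else {x 3}},
    Finset.card_le_four, fun s hs hc => ?_⟩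
  have hs3 : s ⊆ insert (x 3) (insert (x 2) (t 1)) := by
    rw [← h.succ 1 (by omega), ← h.succ 2 (by omega)]
    exact (h.ssubset_of_compatible (k := 3) (by omega) hs fun j hj => hc j (Or.inr hj)).1
  have hs3' : s ≠ insert (x 3) (insert (x 2) (t 1)) := by
    rw [← h.succ 1 (by omega), ← h.succ 2 (by omega)]
    exact (h.ssubset_of_compatible (k := 3) (by omega) hs fun j hj => hc j (Or.inr hj)).ne
  have hne := nonempty_of_induce_connected hs.2
  simp only [Finset.mem_insert, Finset.mem_singleton]
  obtain ⟨hs1, hc⟩ := hc 1 (Or.inl rfl) (by omega)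
  rcases hc with hc | hc | ⟨hd, hadj⟩
  · have hsub := hc.1
    rw [h.t_one hn] at hsub hs1
    by_cases h0 : x 0 ∈ s
    · left
      have h1 : x 1 ∉ s := fun h1 => hs1 (hsub.antisymm (by simp [Finset.insert_subset_iff, *]))
      ext z
      constructor
      · intro hz
        rcases Finset.mem_insert.1 (hsub hz) with rfl | hz'
        · exact absurd hz h1
        · exact hz'
      · intro hz
        rwa [Finset.mem_singleton.1 hz]
    · right; left
      refine (Finset.Nonempty.subset_singleton_iff hne).1 fun z hz => ?_
      rcases Finset.mem_insert.1 (hsub hz) with rfl | hz'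
      · simp
      · exact absurd hz (Finset.mem_singleton.1 hz' ▸ h0)
  · by_cases h3 : x 3 ∈ s
    · have h2 : x 2 ∉ s := fun h2 => hs3' (hs3.antisymm (by
        simp only [Finset.insert_subset_iff]
        exact ⟨h3, h2, hc.1⟩))
      have e : s = insert (x 3) (t 1) := by
        refine Finset.Subset.antisymm (fun z hz => ?_) (Finset.insert_subset h3 hc.1)
        have := hs3 hz
        simp only [Finset.mem_insert] at this ⊢
        rcases this with rfl | rfl | this
        · exact Or.inl rfl
        · exact absurd hz h2
        · exact Or.inr this
      obtain ⟨a, ha, b, hb, hb1, hab⟩ := exists_adj_of_induce_connected hs.2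
        ⟨x 0, by rw [h.t_one hn]; simp⟩ hc
      rw [e] at hb
      obtain rfl := (Finset.mem_insert.1 hb).resolve_right hb1
      right; right; right
      rw [if_pos ⟨a, ha, hab⟩, e]
    · right; right; left
      rw [h.succ 1 (by omega)]
      have hsub : s ⊆ insert (x 2) (t 1) := (Finset.subset_insert_iff_of_notMem h3).1 hs3
      refine Finset.eq_of_subset_of_card_le hsub ?_
      have := Finset.card_lt_card hc
      exact (Finset.card_insert_le (x 2) (t 1)).trans this
  · have h2 : x 2 ∉ s := by
      intro h2
      obtain ⟨a, ha, hax⟩ := h.adj 1 (by omega)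
      exact hadj _ h2 a ha hax.symm
    have e : s = {x 3} := by
      refine (Finset.Nonempty.subset_singleton_iff hne).1 fun z hz => ?_
      have := hs3 hz
      simp only [Finset.mem_insert] at this
      rcases this with rfl | rfl | this
      · simp
      · exact absurd hz h2
      · exact absurd this (Finset.disjoint_left.1 hd hz)
    right; right; right
    rw [if_neg, e]
    rintro ⟨a, ha, hax⟩
    exact hadj (x 3) (by simp [e]) a ha hax.symm

/-- There are at least five tubes properly contained in `t 2`. -/
theorem exists_five_tubes (hn : 4 ≤ Fintype.card V) : ∃ D : Finset (Finset V), D.card = 5 ∧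
    ∀ s ∈ D, (G.induce (s : Set V)).Connected ∧ s ⊂ t 2 := by
  obtain ⟨a, ha, hax⟩ := h.adj 1 (by omega)
  have h01 : x 1 ≠ x 0 := by simpa [h.zero] using h.notMem 0 (by omega)
  have h2 := h.notMem 1 (by omega)
  simp only [Nat.reduceAdd] at hax h2
  have hss : ∀ s ⊆ t 2, s.card ≤ 2 → s ⊂ t 2 := fun s hs hc =>
    hs.ssubset_of_ne fun e => by
      rw [e, h.card_eq (by omega)] at hc
      omega
  have hconn1 := h.connected (i := 1) (by omega)
  have h1 := h.t_one hn
  have hax2 := induce_insert_connected (induce_singleton_connected (G := G) a)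
    (Finset.mem_singleton_self a) hax
  rw [h1] at ha h2 hconn1
  simp only [Finset.mem_insert, Finset.mem_singleton, not_or] at ha h2
  have hs2 : ∀ z ∈ ({x 2, x 1, x 0} : Finset V), ({z} : Finset V) ⊂ t 2 := fun z hz =>
    hss _ (by rw [h.t_two hn]; simpa using hz) (by simp)
  -- Three singletons and two edges of the connected graph on `t 2`, where `a` is a neighbor of `x
  -- 2` in `t 1`.
  refine ⟨{{x 0}, {x 1}, {x 2}, {x 1, x 0}, {x 2, a}}, ?_, ?_⟩
  · have ne : ∀ s r : Finset V, s.card ≠ r.card → s ≠ r := fun s r h e => h (e ▸ rfl)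
    have c₁ : ({x 1, x 0} : Finset V).card = 2 := Finset.card_pair h01
    have h2a : x 2 ≠ a := by rcases ha with rfl | rfl <;> tauto
    have c₂ : ({x 2, a} : Finset V).card = 2 := Finset.card_pair h2a
    have n₁ : ∀ z, ({z} : Finset V) ≠ {x 1, x 0} := fun z => ne _ _ (by simp [c₁])
    have n₂ : ∀ z, ({z} : Finset V) ≠ {x 2, a} := fun z => ne _ _ (by simp [c₂])
    have n₃ : ({x 1, x 0} : Finset V) ≠ {x 2, a} := by
      intro e
      have : x 2 ∈ ({x 1, x 0} : Finset V) := by rw [e]; simp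
      simp [h2] at this
    have s₁ : x 0 ≠ x 2 := fun e => h2.2 e.symm
    have s₂ : x 1 ≠ x 2 := fun e => h2.1 e.symm
    simp [n₁, n₂, n₃, s₁, s₂, h01.symm]
  · simp only [Finset.mem_insert, Finset.mem_singleton]
    rintro s (rfl | rfl | rfl | rfl | rfl)
    · exact ⟨induce_singleton_connected _, hs2 _ (by simp)⟩
    · exact ⟨induce_singleton_connected _, hs2 _ (by simp)⟩
    · exact ⟨induce_singleton_connected _, hs2 _ (by simp)⟩
    · exact ⟨hconn1, hss _ (by rw [h.t_two hn]; exact Finset.subset_insert _ _)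
        Finset.card_le_two⟩
    · refine ⟨hax2, hss _ ?_ Finset.card_le_two⟩
      rw [h.t_two hn]
      simp only [Finset.insert_subset_iff, Finset.singleton_subset_iff, Finset.mem_insert,
        Finset.mem_singleton]
      tauto

end IsConnectedChain

end Chain

/-! ### Comparison of the two faces. -/

section Regular

variable {V : Type*} [Fintype V] [DecidableEq V] {C : Type*} {G : SimpleGraph V}
  {palette : Multiset C}

open ColorTemplate

/-- With cores this small, covered templates are counted by their tubings. -/
theorem encard_step_le {F : ColorTemplate G palette}
    (hF : ∀ s ∈ insert Finset.univ F.tubing, (coreNodes F.tubing s).card ≤ 2)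
    (D : Finset (Finset V))
    (hD : ∀ s ∉ F.tubing, IsTubing G (insert s F.tubing) → s ∈ D) :
    {P | Step P F}.encard ≤ D.card := by
  classical
  have hmaps : Set.MapsTo ColorTemplate.tubing {P | Step P F}
      (D.image fun s => insert s F.tubing : Finset (Finset (Finset V))) := by
    intro P hP
    obtain ⟨s, u, hs, e, -⟩ := hP
    rw [Finset.mem_coe, Finset.mem_image]
    exact ⟨s, hD s hs (e ▸ P.isTubing), e.symm⟩
  refine (Set.encard_le_encard_of_injOn hmaps fun P hP Q hQ e => ?_).trans ?_
  · exact Step.eq_of_tubing_eq hP hQ e hF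
  · rw [Set.encard_coe_eq_coe_finsetCard]
    exact_mod_cast Finset.card_image_le

theorem le_encard_step (hG : G.Connected) {F : ColorTemplate G palette} (D : Finset (Finset V))
    (hD : ∀ s ∈ D, s ∉ F.tubing ∧ IsTubing G (insert s F.tubing)) :
    (D.card : ℕ∞) ≤ {P | Step P F}.encard := by
  have : Nonempty (ColorTemplate G palette) := ⟨F⟩
  choose! f hf hft using fun s hs => exists_step hG F (hD s hs).1 (hD s hs).2
  rw [← Set.encard_coe_eq_coe_finsetCard]
  refine Set.encard_le_encard_of_injOn (f := f) hf fun s hs r hr e => ?_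
  have h₁ := hft s hs
  rw [e, hft r hr] at h₁
  have : s ∈ insert r F.tubing := h₁ ▸ Finset.mem_insert_self _ _
  exact (Finset.mem_insert.1 this).resolve_right (hD s hs).1

/-- The set `t 1` has two nodes, `t 3` has two more, and from there on each set has one more. -/
theorem IsConnectedChain.card_coreNodes_le {t : ℕ → Finset V} {x : ℕ → V}
    (h : IsConnectedChain G t x) (hn : 4 ≤ Fintype.card V) {I : Finset ℕ}
    (hI : ∀ i, i ∈ I ↔ (i = 1 ∨ 3 ≤ i) ∧ i + 1 < Fintype.card V) {s : Finset V}
    (hs : s ∈ insert Finset.univ (I.image t)) : (coreNodes (I.image t) s).card ≤ 2 := by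
  obtain ⟨i, hi, hin, rfl⟩ : ∃ i, (i = 1 ∨ 3 ≤ i) ∧ i < Fintype.card V ∧ s = t i := by
    rcases Finset.mem_insert.1 hs with rfl | hs
    · exact ⟨Fintype.card V - 1, by omega, by omega, (h.eq_univ (by omega)).symm⟩
    · obtain ⟨i, hi, rfl⟩ := Finset.mem_image.1 hs
      have := (hI i).1 hi
      exact ⟨i, this.1, by omega, rfl⟩
  have hsub : ∀ j ∈ I, j < i → coreNodes (I.image t) (t i) ⊆ t i \ t j := by
    intro j hj hji v hv
    obtain ⟨h₁, h₂⟩ := mem_coreNodes.1 hv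
    exact Finset.mem_sdiff.2 ⟨h₁, h₂ _ (Finset.mem_image_of_mem t hj) (h.ssubset hji hin)⟩
  have hcard : ∀ j ∈ I, j < i → i ≤ j + 2 → (coreNodes (I.image t) (t i)).card ≤ 2 := by
    intro j hj hji hij
    refine (Finset.card_le_card (hsub j hj hji)).trans ?_
    rw [Finset.card_sdiff_of_subset (h.subset hji.le hin), h.card_eq hin,
      h.card_eq (hji.trans hin)]
    omega
  rcases hi with rfl | hi
  · exact (Finset.card_le_card (Finset.filter_subset _ _)).trans (h.card_eq hin).le
  · rcases hi.eq_or_lt with rfl | hi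
    · exact hcard 1 ((hI 1).2 ⟨Or.inl rfl, by omega⟩) (by omega) (by omega)
    · exact hcard (i - 1) ((hI _).2 ⟨Or.inr (by omega), by omega⟩) (by omega) (by omega)

/-- On four or more nodes there are both square and non-square faces of rank two. -/
theorem not_isRegular (hG : G.Connected) (hpal : palette.card + 1 = Fintype.card V)
    (hn : 4 ≤ Fintype.card V) (P₀ : TopTemplate G palette) :
    ¬ IsRegular (Associahedron G palette P₀) := by
  intro hreg
  obtain ⟨t, x, h⟩ := exists_isConnectedChain hG
  have hbelow : ∀ (Q : ColorTemplate G palette) (I J : Finset ℕ), Q.tubing = I.image t → I ⊂ J →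
      (∀ i ∈ J, i + 1 < Fintype.card V) → ∃ P, P < Q ∧ P.tubing = J.image t := by
    intro Q I J hQ hIJ hJ
    obtain ⟨P, hP, hPT⟩ := Q.exists_le hG _ (h.isTubing hJ)
      (hQ ▸ Finset.image_subset_image hIJ.1)
    refine ⟨P, hP.lt_of_ne fun e => ?_, hPT⟩
    have hinj := h.injOn (I := J) fun i hi => by have := hJ i hi; omega
    have h₁ := Finset.card_image_of_injOn hinj
    have h₂ := Finset.card_image_of_injOn (hinj.mono (Finset.coe_subset.2 hIJ.1))
    rw [← hPT, e, hQ, h₂] at h₁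
    exact (Finset.card_lt_card hIJ).ne h₁
  -- The members `t 0, …, t (m - 1)` are tubes, and `t m` is the universal tube.
  set m := Fintype.card V - 1 with hm
  have hface : ∀ k, k = 1 ∨ k = 2 → ∃ F : ColorTemplate G palette, ∃ hF : F ≤ P₀.1,
      F.tubing = (insert k (Finset.Ico 3 m)).image t ∧
      Order.height (face P₀ F hF) = 3 ∧
      {X | X ⋖ face P₀ F hF}.encard = {P | Step P F}.encard := by
    intro k hk
    have hmem : ∀ i ∈ insert k (Finset.Ico 3 m), i + 1 < Fintype.card V := by
      intro i hi
      simp only [Finset.mem_insert, Finset.mem_Ico] at hi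
      omega
    obtain ⟨F, hF, hFT⟩ := P₀.1.exists_le hG _ (h.isTubing hmem) (by simp [P₀.2])
    obtain ⟨E, hEF, hET⟩ := hbelow F _ (Finset.Ico 1 m) hFT (by
      rw [Finset.ssubset_iff_of_subset]
      -- Of the indices 1 and 2, this is the one that `F` lacks.
      · refine ⟨3 - k, ?_, ?_⟩ <;> simp only [Finset.mem_insert, Finset.mem_Ico] <;> omega
      · intro i hi
        simp only [Finset.mem_insert, Finset.mem_Ico] at hi ⊢
        omega) (by intro i hi; rw [Finset.mem_Ico] at hi; omega)
    obtain ⟨P, hPE, -⟩ := hbelow E _ (Finset.Ico 0 m) hET (by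
      rw [Finset.ssubset_iff_of_subset]
      · refine ⟨0, ?_, ?_⟩ <;> simp only [Finset.mem_Ico] <;> omega
      · intro i hi
        simp only [Finset.mem_Ico] at hi ⊢
        omega) (by intro i hi; rw [Finset.mem_Ico] at hi; omega)
    refine ⟨F, hF, hFT, height_face_eq_three hpal P₀ hF hPE hEF ?_, encard_covBy_face P₀ hF hEF⟩
    rw [hFT, Finset.card_image_of_injOn (h.injOn fun i hi => by have := hmem i hi; omega),
      Finset.card_insert_of_notMem (by rw [Finset.mem_Ico]; omega), Nat.card_Ico]
    omega
  obtain ⟨F, hF, hFT, hFh, hFc⟩ := hface 1 (Or.inl rfl)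
  obtain ⟨F', hF', hFT', hFh', hFc'⟩ := hface 2 (Or.inr rfl)
  have heq := hreg.encard_covBy_eq (hFh.trans hFh'.symm) (by rw [hFh]; exact ENat.natCast_lt_top 3)
  rw [hFc, hFc'] at heq
  obtain ⟨D, hD, hDmem⟩ := h.exists_candidates hn
  obtain ⟨D', hD', hDmem'⟩ := h.exists_five_tubes hn
  have hle : {P | Step P F}.encard ≤ D.card := by
    refine encard_step_le (fun s hs => ?_) D fun s hs hsT => ?_
    · rw [hFT] at hs ⊢
      refine h.card_coreNodes_le hn (fun i => ?_) hs
      simp only [Finset.mem_insert, Finset.mem_Ico]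
      omega
    · refine hDmem s (hsT.1 s (Finset.mem_insert_self _ _)) fun j hj hjn => ?_
      have hjT : t j ∈ F.tubing := by
        rw [hFT]
        refine Finset.mem_image_of_mem t ?_
        simp only [Finset.mem_insert, Finset.mem_Ico]
        omega
      have hne : s ≠ t j := fun e => hs (e ▸ hjT)
      exact ⟨hne, hsT.2 s (Finset.mem_insert_self _ _) _ (Finset.mem_insert_of_mem hjT) hne⟩
  have hge : (D'.card : ℕ∞) ≤ {P | Step P F'}.encard := by
    refine le_encard_step hG D' fun s hs => ?_
    obtain ⟨hsc, hst⟩ := hDmem' s hs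
    have hsub : ∀ i ∈ insert 2 (Finset.Ico 3 m), s ⊂ t i := by
      intro i hi
      simp only [Finset.mem_insert, Finset.mem_Ico] at hi
      exact hst.trans_subset (h.subset (by omega) (by omega))
    rw [hFT']
    refine ⟨fun hmem => ?_, h.isTubing_insert (fun i hi => ?_) hsc hsub fun e => ?_⟩
    · obtain ⟨i, hi, rfl⟩ := Finset.mem_image.1 hmem
      exact ssubset_irrefl _ (hsub i hi)
    · simp only [Finset.mem_insert, Finset.mem_Ico] at hi
      omega
    · exact (e ▸ hst).2 (Finset.subset_univ _)
  rw [hD', ← heq] at hge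
  have h54 : ((5 : ℕ) : ℕ∞) ≤ ((4 : ℕ) : ℕ∞) := (hge.trans hle).trans (by exact_mod_cast hD)
  exact absurd (Nat.cast_le.1 h54) (by norm_num)

end Regular

/-! ### Connected graphs on at most three nodes. -/

section SmallGraphs

variable {V : Type*} {G : SimpleGraph V}

theorem nonempty_iso_completeGraph [Fintype V] (hG : ∀ a b, a ≠ b → G.Adj a b) {n : ℕ}
    (hn : Fintype.card V = n) : Nonempty (G ≃g SimpleGraph.completeGraph (Fin n)) := by
  refine ⟨⟨Fintype.equivFinOfCardEq hn, fun {a b} => ?_⟩⟩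
  simp only [SimpleGraph.completeGraph, SimpleGraph.top_adj, ne_eq, EmbeddingLike.apply_eq_iff_eq]
  exact ⟨hG a b, fun h => h.ne⟩

theorem nonempty_iso_pathGraph_three {a b c : V} (hab : a ≠ b) (hbc : b ≠ c) (hac : a ≠ c)
    (huniv : ∀ v, v = a ∨ v = b ∨ v = c) (h₁ : G.Adj a b) (h₂ : G.Adj b c) (h₃ : ¬ G.Adj a c) :
    Nonempty (G ≃g SimpleGraph.pathGraph 3) := by
  let f : Fin 3 → V := ![a, b, c]
  have hf : Function.Bijective f := by
    constructor
    · intro i j hij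
      fin_cases i <;> fin_cases j <;> simp_all [f, eq_comm]
    · intro v
      rcases huniv v with rfl | rfl | rfl
      · exact ⟨0, rfl⟩
      · exact ⟨1, rfl⟩
      · exact ⟨2, rfl⟩
  have h₁' := h₁.symm
  have h₂' := h₂.symm
  have h₃' : ¬ G.Adj c a := fun h => h₃ h.symm
  refine ⟨(SimpleGraph.Iso.symm ⟨Equiv.ofBijective f hf, fun {i j} => ?_⟩)⟩
  rw [SimpleGraph.pathGraph_adj]
  fin_cases i <;> fin_cases j <;> simp_all [f]

theorem exists_adj_of_connected [Fintype V] (hG : G.Connected) (hn : 2 ≤ Fintype.card V) (a : V) :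
    ∃ b, G.Adj a b := by
  have : Nontrivial V := Fintype.one_lt_card_iff_nontrivial.1 hn
  exact hG.preconnected.exists_adj_of_nontrivial a

/-- If two nodes are not adjacent, they and a neighbor of one of them are all the nodes. That
neighbor is then the only possible neighbor of the other, which gives a path. -/
theorem small_connected_graph [Fintype V] (hG : G.Connected) (hn : Fintype.card V ≤ 3) :
    Nonempty (G ≃g SimpleGraph.completeGraph (Fin 1)) ∨
      Nonempty (G ≃g SimpleGraph.completeGraph (Fin 2)) ∨
      Nonempty (G ≃g SimpleGraph.completeGraph (Fin 3)) ∨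
      Nonempty (G ≃g SimpleGraph.pathGraph 3) := by
  classical
  by_cases hc : ∀ a b, a ≠ b → G.Adj a b
  · have : Nonempty V := hG.nonempty
    have hpos : 0 < Fintype.card V := Fintype.card_pos
    obtain h | h | h : Fintype.card V = 1 ∨ Fintype.card V = 2 ∨ Fintype.card V = 3 := by omega
    · exact Or.inl (nonempty_iso_completeGraph hc h)
    · exact Or.inr (Or.inl (nonempty_iso_completeGraph hc h))
    · exact Or.inr (Or.inr (Or.inl (nonempty_iso_completeGraph hc h)))
  · push Not at hc
    obtain ⟨a, c, hac, hnac⟩ := hc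
    have h2 : 2 ≤ Fintype.card V := Fintype.one_lt_card_iff.2 ⟨a, c, hac⟩
    obtain ⟨b, hab⟩ := exists_adj_of_connected hG h2 a
    obtain ⟨b', hcb⟩ := exists_adj_of_connected hG h2 c
    have hbc : b ≠ c := fun e => hnac (e ▸ hab)
    have huniv : ∀ v, v = a ∨ v = b ∨ v = c := by
      intro v
      have he : ({a, b, c} : Finset V) = Finset.univ :=
        Finset.eq_univ_of_card _ (le_antisymm (Finset.card_le_univ _) (by
          rw [Finset.card_eq_three.2 ⟨a, b, c, hab.ne, hac, hbc, rfl⟩]; exact hn))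
      have : v ∈ ({a, b, c} : Finset V) := he ▸ Finset.mem_univ v
      simpa using this
    obtain rfl : b' = b := by
      rcases huniv b' with rfl | rfl | rfl
      · exact absurd hcb.symm hnac
      · rfl
      · exact absurd hcb (G.irrefl)
    exact Or.inr (Or.inr (Or.inr
      (nonempty_iso_pathGraph_three hab.ne hbc hac huniv hab hcb.symm hnac)))

end SmallGraphs

end ColorfulGA

theorem lemma5p6 {V : Type*} [Fintype V] [DecidableEq V] (G : SimpleGraph V) (hG : G.Connected)
    {C : Type*} (palette : Multiset C) (hpalette : ColorfulGA.IsFullPalette V palette)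
    (hreg : ∃ P : ColorfulGA.TopTemplate G palette,
      ColorfulGA.IsRegular (ColorfulGA.Associahedron G palette P)) :
    Nonempty (G ≃g SimpleGraph.completeGraph (Fin 1)) ∨
      Nonempty (G ≃g SimpleGraph.completeGraph (Fin 2)) ∨
      Nonempty (G ≃g SimpleGraph.completeGraph (Fin 3)) ∨
      Nonempty (G ≃g SimpleGraph.pathGraph 3) := by
  obtain ⟨P, hP⟩ := hreg
  refine ColorfulGA.small_connected_graph hG ?_
  by_contra hn
  exact ColorfulGA.not_isRegular hG hpalette.1 (by omega) P hP
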